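/- A source at the origin of the plane has $n_T\ge 2$ antennas. Eavesdroppers are located at the points of a homogeneous Poisson point process $\Phi_E$ of density $\lambda_E>0$ on $\mathbb R^2$; the $i$-th one is at distance $r_i$ from the source and has small-scale fading vector $\boldsymbol h_i\in\mathbb C^{n_T}$. All entries of all the vectors $\boldsymbol h_i$ are i.i.d. $\mathcal{CN}(0,1)$. Let $\hat{\boldsymbol h}_{sd}\in\mathbb C^{n_T}$ be the estimated legitimate channel, with i.i.d. $\mathcal{CN}(0,1)$ entries, let $\boldsymbol w^{\mathsf T}=\hat{\boldsymbol h}_{sd}^\dagger/\|\hat{\boldsymbol h}_{sd}\|$ be the maximum ratio transmission beamformer, and let $\mathbf G$ be a (measurable) random $n_T\times(n_T-1)$ complex matrix whose columns form, together with $\boldsymbol w$, an orthonormal basis of $\mathbb C^{n_T}$ almost surely. The family $(\boldsymbol h_i)_i$ is independent of the locations, of $\hat{\boldsymbol h}_{sd}$ and of $\mathbf G$ (jointly). Let $P_s>0$, $\sigma_n>0$, $0<\zeta\le 1$ and $\eta>2$ be the transmit power, the noise power, the fraction of power given to the information signal, and the path-loss exponent. The SINR at the $i$-th eavesdropper is $$\gamma_{E_i}=\frac{\zeta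 P_s r_i^{-\eta}|\boldsymbol w^{\mathsf T}\boldsymbol h_i|^2}{(1-\zeta)P_s\|\boldsymbol h_i^{\mathsf T}\mathbf G\|^2 r_i^{-\eta}/(n_T-1)+\sigma_n}.$$ Then almost surely the maximum $\gamma_E^{\mathsf{NCE}}=\max_{i\in\Phi_E}\gamma_{E_i}$ (the SINR of the wiretap channel when the eavesdroppers do not collude) exists, and its CDF is $$F_{\gamma_E^{\mathsf{NCE}}}(\omega)=\exp\left(-\beta\lambda_E\left(\zeta\frac{P_s}{\sigma_n}\right)^{2/\eta}\omega^{-2/\eta}\left(1+\frac{1/\zeta-1}{n_T-1}\,\omega\right)^{1-n_T}\right)\qquad(\omega>0),$$ where $\beta=\pi\Gamma(1+2/\eta)$, and $F_{\gamma_E^{\mathsf{NCE}}}(\omega)=0$ for $\omega\le 0$. -/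

import Mathlib

open MeasureTheory ProbabilityTheory

noncomputable section

/-- The Euclidean plane, with its Borel sigma-algebra and Lebesgue (area) measure `volume`. -/
abbrev Plane : Type := EuclideanSpace ℝ (Fin 2)

/-- The number of points of the configuration `x₀, x₁, …` (counted with multiplicity)
that lie in `B`. -/
def pointCount (x : ℕ → Plane) (B : Set Plane) : ℕ∞ := {i | x i ∈ B}.encard

/-- The random points `X 0, X 1, …` enumerate a Poisson point process on the plane with intensity
measure `Λ`: the number of points in a set `B` of finite `Λ`-measure is Poisson distributed with
mean `Λ B`, and the numbers of points in pairwise disjoint sets are independent. (An enumeration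
by `ℕ` fits the case where the process has infinitely many points, e.g. `Λ` a positive multiple of
Lebesgue measure.) -/
structure IsPoissonPointProcess {Ω : Type*} [MeasurableSpace Ω] (P : Measure Ω)
    (Λ : Measure Plane) (X : ℕ → Ω → Plane) : Prop where
  measurable : ∀ i, Measurable (X i)
  hasLaw_count : ∀ B : Set Plane, MeasurableSet B → Λ B < ⊤ →
    HasLaw (fun ω => pointCount (fun i => X i ω) B)
      ((poissonMeasure (Λ B).toNNReal).map (fun k : ℕ => (k : ℕ∞))) P
  indep_count : ∀ (m : ℕ) (B : Fin m → Set Plane), (∀ j, MeasurableSet (B j)) →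
    Pairwise (fun j k => Disjoint (B j) (B k)) →
    iIndepFun (fun (j : Fin m) (ω : Ω) => pointCount (fun i => X i ω) (B j)) P

/-- The circularly symmetric complex Gaussian distribution `CN(0,1)`: real and imaginary part are
independent real Gaussians with mean `0` and variance `1/2`. -/
def stdComplexGaussian : Measure ℂ :=
  ((gaussianReal 0 (1 / 2)).prod (gaussianReal 0 (1 / 2))).map
    (fun p : ℝ × ℝ => (⟨p.1, p.2⟩ : ℂ))

/-- The Euclidean (`ℓ²`) norm of a complex vector. -/
def l2norm {m : ℕ} (v : Fin m → ℂ) : ℝ := ‖WithLp.toLp 2 v‖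

/-- The maximum ratio transmission beamformer `w` for the estimated channel `g`, given by
`wᵀ = g† / ‖g‖`. -/
def mrtBeamformer {n : ℕ} (g : Fin n → ℂ) : Fin n → ℂ :=
  fun k => star (g k) / (l2norm g : ℂ)

/-- The vector `w` and the `n - 1` columns of `G` are orthonormal in `ℂⁿ` (Hermitian inner product);
there are `n` of them when `n ≥ 1`, so they form an orthonormal basis. -/
def IsCompletedBy {n : ℕ} (w : Fin n → ℂ) (G : Matrix (Fin n) (Fin (n - 1)) ℂ) : Prop :=
  Orthonormal ℂ (fun o : Option (Fin (n - 1)) =>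
    (WithLp.toLp 2 (o.elim w (fun j k => G k j)) : EuclideanSpace ℂ (Fin n)))

/-- SINR at an eavesdropper at distance `r` from the source with small-scale fading vector `h`,
when the source transmits with total power `Ps`, a fraction `ζ` of which goes to the information
signal along `w` and the rest to artificial noise along the columns of `G`; `η` is the path-loss
exponent and `σn` the power of the receiver noise. -/
def eveSINR {n : ℕ} (ζ Ps σn η : ℝ) (w : Fin n → ℂ) (G : Matrix (Fin n) (Fin (n - 1)) ℂ)
    (r : ℝ) (h : Fin n → ℂ) : ℝ :=
  (ζ * Ps * r ^ (-η) * ‖w ⬝ᵥ h‖ ^ 2) /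
    ((1 - ζ) * Ps * l2norm (Matrix.vecMul h G) ^ 2 * r ^ (-η) / ((n : ℝ) - 1) + σn)

/-- The system model: a source with `n` antennas at the origin, and eavesdroppers.
`X i` is the location of the `i`-th eavesdropper, `h i` its small-scale fading vector, `hsd` the
estimated legitimate channel, and `G` the artificial-noise matrix that the source chooses. -/
structure IsWiretapModel {Ω : Type*} [MeasurableSpace Ω] (P : Measure Ω) (n : ℕ) (lamE : ℝ)
    (X : ℕ → Ω → Plane) (h : ℕ → Ω → Fin n → ℂ) (hsd : Ω → Fin n → ℂ)
    (G : Ω → Matrix (Fin n) (Fin (n - 1)) ℂ) : Prop where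
  /-- The eavesdroppers form a homogeneous Poisson point process of density `lamE`. -/
  poisson : IsPoissonPointProcess P (ENNReal.ofReal lamE • volume) X
  measurable_h : ∀ i, Measurable (h i)
  measurable_hsd : Measurable hsd
  measurable_G : Measurable (fun ω k j => G ω k j)
  /-- Rayleigh fading: all entries of all fading vectors are i.i.d. `CN(0,1)`. -/
  law_h : ∀ i k, HasLaw (fun ω => h i ω k) stdComplexGaussian P
  indep_h : iIndepFun (fun (p : ℕ × Fin n) (ω : Ω) => h p.1 ω p.2) P
  law_hsd : ∀ k, HasLaw (fun ω => hsd ω k) stdComplexGaussian P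
  indep_hsd : iIndepFun (fun (k : Fin n) (ω : Ω) => hsd ω k) P
  /-- The fading of the eavesdroppers' links is independent of their locations, of the legitimate
  channel and of the noise matrix chosen by the source. -/
  indep_links : IndepFun (fun ω i => h i ω) (fun ω => ((fun i => X i ω), hsd ω, (fun k j => G ω k j))) P
  /-- The beamforming vector and the columns of `G` form an orthonormal basis. -/
  basis : ∀ᵐ ω ∂P, IsCompletedBy (mrtBeamformer (hsd ω)) (G ω)

/-- The SINR of the `i`-th eavesdropper. -/
def sinrE {Ω : Type*} {n : ℕ} (ζ Ps σn η : ℝ) (X : ℕ → Ω → Plane) (h : ℕ → Ω → Fin n → ℂ)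
    (hsd : Ω → Fin n → ℂ) (G : Ω → Matrix (Fin n) (Fin (n - 1)) ℂ) (i : ℕ) (ω : Ω) : ℝ :=
  eveSINR ζ Ps σn η (mrtBeamformer (hsd ω)) (G ω) ‖X i ω‖ (h i ω)

/-- The SINR of the equivalent wiretap channel for non-colluding eavesdroppers: the largest
of their SINRs. -/
def sinrNCE {Ω : Type*} {n : ℕ} (ζ Ps σn η : ℝ) (X : ℕ → Ω → Plane) (h : ℕ → Ω → Fin n → ℂ)
    (hsd : Ω → Fin n → ℂ) (G : Ω → Matrix (Fin n) (Fin (n - 1)) ℂ) (ω : Ω) : ℝ :=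
  ⨆ i, sinrE ζ Ps σn η X h hsd G i ω

end

open scoped ENNReal NNReal

/-! Condition on the locations, the legitimate channel and `G`. The fading vectors stay i.i.d.
standard complex Gaussian, so the SINRs are conditionally independent. By unitary invariance, `w ⬝ᵥ
h` and the entries of `Matrix.vecMul h G` are i.i.d. `CN(0,1)`. Clearing denominators turns "SINR
above `x`" into `c * ∑ ‖z_j‖² + s < ‖z_0‖²`. As `‖z_0‖²` is exponential, this has probability
`exp(-s) * (1 + c)^(1 - n)`, which depends on the conditioning only through the distance
(`sinrTail`).

Hence the probability that no SINR exceeds `x` is the mean of `∏ (1 - p (X i))` with `p = sinrTail`.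
The generating functional of the Poisson process (`iInf_lintegral_prod`) equates it with `exp(-∫ p
dΛ)`, and the integral over the plane is a Gamma integral. The functional is proved for simple
functions, where the product regroups into powers of independent Poisson counts, and then by
monotone approximation.

The same integral bounds the sum of the tail probabilities. By Borel-Cantelli only finitely many
SINRs exceed a given positive level, and all are almost surely positive, so the supremum is
attained. -/

/-! ### Moments of the Poisson law and counting of points -/

lemma lintegral_natCast_poissonMeasure (r : ℝ≥0) :
    ∫⁻ k, (k : ℝ≥0∞) ∂(poissonMeasure r) = r := by
  -- The mass at `k + 1` times `k + 1` is `r` times the mass at `k`, so the mean is `r` times the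
  -- total mass.
  have hs : ∀ k : ℕ, ENNReal.ofReal (Real.exp (-r) * r ^ (k + 1) / (k + 1).factorial)
      * ((k + 1 : ℕ) : ℝ≥0∞) = r * ENNReal.ofReal (Real.exp (-r) * r ^ k / k.factorial) := by
    intro k
    rw [← ENNReal.ofReal_natCast, ← ENNReal.ofReal_mul (by positivity), ← ENNReal.ofReal_coe_nnreal,
      ← ENNReal.ofReal_mul (by positivity)]
    congr 1
    rw [Nat.factorial_succ]
    push_cast
    field_simp
    ring
  have h1 := hasSum_one_poissonMeasure r
  rw [poissonMeasure, lintegral_sum_measure]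
  simp only [lintegral_smul_measure, lintegral_dirac, smul_eq_mul]
  rw [tsum_eq_zero_add' ENNReal.summable]
  simp only [hs, Nat.cast_zero, mul_zero, zero_add]
  rw [ENNReal.tsum_mul_left, ← ENNReal.ofReal_tsum_of_nonneg (fun _ => by positivity) h1.summable,
    h1.tsum_eq]
  simp

lemma lintegral_pow_poissonMeasure (r : ℝ≥0) {c : ℝ≥0∞} (hc : c ≤ 1) :
    ∫⁻ k, (1 - c) ^ k ∂(poissonMeasure r) = ENNReal.ofReal (Real.exp (-(c.toReal * r))) := by
  have hct : c ≠ ⊤ := ne_top_of_le_ne_top ENNReal.one_ne_top hc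
  have hc1 : c.toReal ≤ 1 := ENNReal.toReal_le_of_le_ofReal zero_le_one (by simpa using hc)
  have hc2 : 1 - c = ENNReal.ofReal (1 - c.toReal) := by
    rw [ENNReal.ofReal_sub _ ENNReal.toReal_nonneg, ENNReal.ofReal_toReal hct, ENNReal.ofReal_one]
  have h0 : 0 ≤ 1 - c.toReal := by linarith
  have hsum := (NormedSpace.expSeries_div_hasSum_exp ((1 - c.toReal) * r : ℝ)).mul_left
    (Real.exp (-r))
  rw [poissonMeasure, lintegral_sum_measure]
  simp only [lintegral_smul_measure, lintegral_dirac, smul_eq_mul]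
  rw [hc2]
  have hs : ∀ k : ℕ, ENNReal.ofReal (Real.exp (-r) * r ^ k / k.factorial)
      * ENNReal.ofReal (1 - c.toReal) ^ k =
      ENNReal.ofReal (Real.exp (-r) * (((1 - c.toReal) * r) ^ k / k.factorial)) := by
    intro k
    rw [← ENNReal.ofReal_pow h0, ← ENNReal.ofReal_mul (by positivity)]
    congr 1
    rw [mul_pow]
    ring
  simp only [hs]
  rw [← ENNReal.ofReal_tsum_of_nonneg (fun _ => by positivity) hsum.summable, hsum.tsum_eq,
    ← Real.exp_eq_exp_ℝ, ← Real.exp_add]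
  congr 2
  ring

lemma toENNReal_pointCount (x : ℕ → Plane) (B : Set Plane) :
    (pointCount x B : ℝ≥0∞) = ∑' i, B.indicator (fun _ => (1 : ℝ≥0∞)) (x i) := by
  rw [pointCount, ← ENNReal.tsum_set_one, tsum_subtype {i | x i ∈ B} (fun _ => (1 : ℝ≥0∞))]
  rfl

lemma antitone_prod_range_one_sub (u : ℕ → ℝ≥0∞) :
    Antitone fun N => ∏ i ∈ Finset.range N, (1 - u i) := by
  refine antitone_nat_of_succ_le fun N => ?_
  rw [Finset.prod_range_succ]
  exact mul_le_of_le_one_right' tsub_le_self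

/-! ### Poisson point processes: mean measure and generating functional -/

namespace IsPoissonPointProcess

variable {Ω : Type*} [MeasurableSpace Ω] {P : Measure Ω}
  {Λ : Measure Plane} {X : ℕ → Ω → Plane}

/-- In `ℝ≥0∞` the count is a sum of indicators; since `ℕ∞` is countable, measurability of the fibres
is enough. -/
lemma measurable_pointCount (hX : IsPoissonPointProcess P Λ X) {B : Set Plane}
    (hB : MeasurableSet B) : Measurable fun ω => pointCount (fun i => X i ω) B := by
  have h : Measurable fun ω => (pointCount (fun i => X i ω) B : ℝ≥0∞) := by
    simp only [toENNReal_pointCount]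
    exact Measurable.tsum fun i => (measurable_const.indicator hB).comp (hX.measurable i)
  refine measurable_to_countable' fun k => ?_
  convert h (measurableSet_singleton (k : ℝ≥0∞)) using 1
  ext ω
  simp

lemma lintegral_pointCount (hX : IsPoissonPointProcess P Λ X) {B : Set Plane}
    (hB : MeasurableSet B) (hΛ : Λ B < ⊤) :
    ∫⁻ ω, (pointCount (fun i => X i ω) B : ℝ≥0∞) ∂P = Λ B := by
  have h := hX.hasLaw_count B hB hΛ
  rw [← lintegral_map (f := fun k : ℕ∞ => (k : ℝ≥0∞)) .of_discrete (hX.measurable_pointCount hB),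
    h.map_eq, lintegral_map .of_discrete .of_discrete]
  simp only [ENat.toENNReal_coe, lintegral_natCast_poissonMeasure, ENNReal.coe_toNNReal hΛ.ne]

/-- On sets of finite `Λ`-measure both sides are the expected count; on the others the bound is
trivial. The inequality is all that is needed below. -/
lemma sum_map_le (hX : IsPoissonPointProcess P Λ X) :
    Measure.sum (fun i => P.map (X i)) ≤ Λ := by
  refine Measure.le_iff.2 fun B hB => ?_
  rcases eq_or_ne (Λ B) ⊤ with h | h
  · simp [h]
  rw [Measure.sum_apply _ hB, ← hX.lintegral_pointCount hB h.lt_top]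
  simp only [toENNReal_pointCount]
  rw [lintegral_tsum (f := fun i ω => B.indicator (fun _ => (1 : ℝ≥0∞)) (X i ω))
    fun i => ((measurable_const.indicator hB).comp (hX.measurable i)).aemeasurable]
  refine le_of_eq (tsum_congr fun i => ?_)
  rw [Measure.map_apply (hX.measurable i) hB,
    ← lintegral_map (measurable_const.indicator hB) (hX.measurable i), lintegral_indicator_const hB,
    one_mul, Measure.map_apply (hX.measurable i) hB]

/-- One half of Campbell's formula. -/
lemma tsum_lintegral_le (hX : IsPoissonPointProcess P Λ X) {f : Plane → ℝ≥0∞}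
    (hf : Measurable f) : ∑' i, ∫⁻ ω, f (X i ω) ∂P ≤ ∫⁻ y, f y ∂Λ := by
  calc ∑' i, ∫⁻ ω, f (X i ω) ∂P = ∫⁻ y, f y ∂(Measure.sum fun i => P.map (X i)) := by
        rw [lintegral_sum_measure]
        exact tsum_congr fun i => (lintegral_map hf (hX.measurable i)).symm
    _ ≤ ∫⁻ y, f y ∂Λ := lintegral_mono' hX.sum_map_le le_rfl

lemma ae_pointCount_ne_top (hX : IsPoissonPointProcess P Λ X) {B : Set Plane}
    (hB : MeasurableSet B) (hΛ : Λ B < ⊤) :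
    ∀ᵐ ω ∂P, pointCount (fun i => X i ω) B ≠ ⊤ := by
  have h := ae_lt_top (f := fun ω => (pointCount (fun i => X i ω) B : ℝ≥0∞))
    (Measurable.comp (g := fun k : ℕ∞ => (k : ℝ≥0∞)) .of_discrete (hX.measurable_pointCount hB))
    (by rw [hX.lintegral_pointCount hB hΛ]; exact hΛ.ne)
  filter_upwards [h] with ω hω
  simpa using hω.ne

lemma lintegral_pow_pointCount (hX : IsPoissonPointProcess P Λ X) {B : Set Plane}
    (hB : MeasurableSet B) (hΛ : Λ B < ⊤) {c : ℝ≥0∞} (hc : c ≤ 1) :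
    ∫⁻ ω, (1 - c) ^ (pointCount (fun i => X i ω) B).toNat ∂P =
      ENNReal.ofReal (Real.exp (-(c * Λ B).toReal)) := by
  have h := hX.hasLaw_count B hB hΛ
  rw [← lintegral_map (f := fun k : ℕ∞ => (1 - c) ^ k.toNat) .of_discrete
    (hX.measurable_pointCount hB), h.map_eq, lintegral_map .of_discrete .of_discrete]
  simp only [ENat.toNat_natCast, lintegral_pow_poissonMeasure _ hc, ENNReal.toReal_mul]
  rfl

lemma indepFun_pointCount_finset (hX : IsPoissonPointProcess P Λ X) {ι : Type*} [Fintype ι]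
    {B : ι → Set Plane} (hB : ∀ j, MeasurableSet (B j))
    (hd : Pairwise (fun j k => Disjoint (B j) (B k))) :
    iIndepFun (fun (j : ι) (ω : Ω) => pointCount (fun i => X i ω) (B j)) P := by
  have h := hX.indep_count (Fintype.card ι) (fun k => B ((Fintype.equivFin ι).symm k))
    (fun k => hB _) (fun j k hjk => hd (by simpa using hjk))
  exact h.of_precomp (g := (Fintype.equivFin ι).symm) (Equiv.surjective _)

/-- Only finitely many points lie where `s ≠ 0`, so the partial products are eventually constant,
and equal factors can be collected. The value `0` is left out: its fibre may hold infinitely many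
points, but they contribute factors `1`. -/
lemma iInf_prod_simpleFunc (s : SimpleFunc Plane ℝ≥0∞) {x : ℕ → Plane}
    (hx : ∀ c ∈ s.range, c ≠ 0 → pointCount x (s ⁻¹' {c}) ≠ ⊤) :
    ⨅ N, ∏ i ∈ Finset.range N, (1 - s (x i)) =
      ∏ c ∈ s.range.erase 0, (1 - c) ^ (pointCount x (s ⁻¹' {c})).toNat := by
  classical
  have hfin : {i | s (x i) ≠ 0}.Finite := by
    have : {i | s (x i) ≠ 0} ⊆ ⋃ c ∈ s.range.erase 0, {i | x i ∈ s ⁻¹' {c}} := by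
      intro i hi
      simp only [Set.mem_iUnion]
      exact ⟨s (x i), Finset.mem_erase.2 ⟨hi, SimpleFunc.mem_range_self s _⟩, rfl⟩
    refine Set.Finite.subset ((Finset.finite_toSet _).biUnion fun c hc => ?_) this
    have hc' := Finset.mem_erase.1 hc
    exact Set.encard_ne_top_iff.1 (hx c hc'.2 hc'.1)
  obtain ⟨M, hM⟩ : ∃ M, ∀ i, s (x i) ≠ 0 → i < M := by
    obtain ⟨M, hM⟩ := hfin.bddAbove
    exact ⟨M + 1, fun i hi => Nat.lt_succ_of_le (hM hi)⟩
  have hprod : ∀ N, M ≤ N → ∏ i ∈ Finset.range N, (1 - s (x i)) =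
      ∏ i ∈ hfin.toFinset, (1 - s (x i)) := by
    intro N hN
    symm
    refine Finset.prod_subset ?_ ?_
    · intro i hi
      exact Finset.mem_range.2 ((hM i (by simpa using hi)).trans_le hN)
    · intro i _ hi
      have : s (x i) = 0 := by simpa using hi
      simp [this]
  have hinf : ⨅ N, ∏ i ∈ Finset.range N, (1 - s (x i)) =
      ∏ i ∈ hfin.toFinset, (1 - s (x i)) := by
    refine le_antisymm ((iInf_le _ M).trans (hprod M le_rfl).le) (le_iInf fun N => ?_)
    rw [← hprod (max M N) (le_max_left _ _)]
    exact antitone_prod_range_one_sub _ (le_max_right _ _)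
  rw [hinf, ← Finset.prod_fiberwise_of_maps_to (g := fun i => s (x i)) (t := s.range.erase 0)]
  · refine Finset.prod_congr rfl fun c hc => ?_
    have hc' := Finset.mem_erase.1 hc
    have hset : {i | x i ∈ s ⁻¹' {c}} =
        ((hfin.toFinset.filter fun i => s (x i) = c : Finset ℕ) : Set ℕ) := by
      ext i
      simp only [Set.mem_ofPred_eq, Set.mem_preimage, Set.mem_singleton_iff, Finset.coe_filter,
        Set.Finite.mem_toFinset]
      exact ⟨fun h => ⟨h ▸ hc'.1, h⟩, fun h => h.2⟩
    rw [pointCount, hset, Set.encard_coe_eq_coe_finsetCard, ENat.toNat_natCast,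
      Finset.prod_congr rfl (g := fun _ => 1 - c)
        (fun i hi => by rw [(Finset.mem_filter.1 hi).2]), Finset.prod_const]
  · intro i hi
    exact Finset.mem_erase.2 ⟨by simpa using hi, SimpleFunc.mem_range_self s _⟩

lemma iInf_lintegral_prod_simpleFunc [IsProbabilityMeasure P]
    (hX : IsPoissonPointProcess P Λ X)
    (s : SimpleFunc Plane ℝ≥0∞) (hs : ∀ y, s y ≤ 1) (hint : ∫⁻ y, s y ∂Λ ≠ ⊤) :
    ⨅ N, ∫⁻ ω, ∏ i ∈ Finset.range N, (1 - s (X i ω)) ∂P =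
      ENNReal.ofReal (Real.exp (-(∫⁻ y, s y ∂Λ).toReal)) := by
  classical
  rw [SimpleFunc.lintegral_eq_lintegral] at hint ⊢
  have hterm : ∀ c ∈ s.range, c * Λ (s ⁻¹' {c}) ≠ ⊤ := by
    intro c hc
    rw [SimpleFunc.lintegral] at hint
    exact (ENNReal.sum_ne_top.1 hint) c hc
  -- A nonzero level with a fibre of infinite measure would make the integral infinite.
  have hΛ : ∀ c ∈ s.range.erase 0, Λ (s ⁻¹' {c}) < ⊤ := by
    intro c hc
    have hc' := Finset.mem_erase.1 hc
    by_contra h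
    exact hterm c hc'.2 (by rw [not_lt_top_iff.1 h, ENNReal.mul_top hc'.1])
  have hmeas : ∀ c, MeasurableSet (s ⁻¹' {c}) := fun c => s.measurableSet_fiber c
  -- Monotone convergence for a decreasing sequence; the term `N = 0` is the empty product, of
  -- integral `1`.
  rw [← lintegral_iInf]
  · have hae : ∀ᵐ ω ∂P, ⨅ N, ∏ i ∈ Finset.range N, (1 - s (X i ω)) =
        ∏ c : s.range.erase 0,
          (1 - (c : ℝ≥0∞)) ^ (pointCount (fun i => X i ω) (s ⁻¹' {(c : ℝ≥0∞)})).toNat := by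
      have : ∀ᵐ ω ∂P, ∀ c ∈ s.range.erase 0, pointCount (fun i => X i ω) (s ⁻¹' {c}) ≠ ⊤ :=
        (ae_ball_iff (Finset.countable_toSet _)).2 fun c hc =>
          hX.ae_pointCount_ne_top (hmeas c) (hΛ c hc)
      filter_upwards [this] with ω hω
      rw [iInf_prod_simpleFunc s fun c hc hc0 => hω c (Finset.mem_erase.2 ⟨hc0, hc⟩),
        Finset.prod_coe_sort (s.range.erase 0) fun c =>
          (1 - c) ^ (pointCount (fun i => X i ω) (s ⁻¹' {c})).toNat]
    rw [lintegral_congr_ae hae]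
    have hind := hX.indepFun_pointCount_finset (ι := s.range.erase 0)
      (B := fun c => s ⁻¹' {(c : ℝ≥0∞)}) (fun c => hmeas c) (by
        intro c d hcd
        refine Disjoint.preimage _ ?_
        exact Set.disjoint_singleton.2 fun h => hcd (Subtype.ext h))
    have hind2 := hind.comp (fun c k => (1 - (c : ℝ≥0∞)) ^ k.toNat) (fun c => .of_discrete)
    have hprod := lintegral_prod_eq_prod_lintegral_of_indepFun Finset.univ _ hind2
      (fun c => Measurable.comp .of_discrete (hX.measurable_pointCount (hmeas c)))
    simp only [Function.comp_def] at hprod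
    have hone : ∀ c ∈ s.range, c ≤ 1 := by
      intro c hc
      obtain ⟨y, rfl⟩ := SimpleFunc.mem_range.1 hc
      exact hs y
    rw [hprod, Finset.prod_congr rfl fun (c : s.range.erase 0) _ =>
      hX.lintegral_pow_pointCount (hmeas c) (hΛ c c.2) (hone c (Finset.mem_of_mem_erase c.2)),
      ← ENNReal.ofReal_prod_of_nonneg fun _ _ => (Real.exp_pos _).le, ← Real.exp_sum,
      Finset.sum_neg_distrib, Finset.sum_coe_sort (s.range.erase 0)
        (fun c => (c * Λ (s ⁻¹' {c})).toReal), SimpleFunc.lintegral, ENNReal.toReal_sum hterm,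
      Finset.sum_erase _ (by simp)]
  · intro N
    exact Finset.measurable_prod _ fun i _ =>
      (s.measurable.comp (hX.measurable i)).const_sub 1
  · intro N M hNM ω
    exact antitone_prod_range_one_sub _ hNM
  · simp

/-- The probability generating functional of a Poisson point process. -/
theorem iInf_lintegral_prod [IsProbabilityMeasure P] (hX : IsPoissonPointProcess P Λ X)
    {f : Plane → ℝ≥0∞} (hf : Measurable f) (hf1 : ∀ y, f y ≤ 1) (hint : ∫⁻ y, f y ∂Λ ≠ ⊤) :
    ⨅ N, ∫⁻ ω, ∏ i ∈ Finset.range N, (1 - f (X i ω)) ∂P =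
      ENNReal.ofReal (Real.exp (-(∫⁻ y, f y ∂Λ).toReal)) := by
  set s := SimpleFunc.eapprox f
  have hsf : ∀ m y, s m y ≤ f y := fun m y => by
    rw [← SimpleFunc.iSup_eapprox_apply hf y]
    exact le_iSup (fun k => s k y) m
  have hmono : ∀ y, Monotone fun m => s m y := fun y _ _ h => SimpleFunc.monotone_eapprox f h y
  have hlim : ∀ y, Filter.Tendsto (fun m => s m y) Filter.atTop (nhds (f y)) := fun y => by
    have := tendsto_atTop_iSup (hmono y)
    rwa [show ⨆ m, s m y = f y from SimpleFunc.iSup_eapprox_apply hf y] at this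
  have hsint : ∀ m, ∫⁻ y, s m y ∂Λ ≤ ∫⁻ y, f y ∂Λ := fun m => lintegral_mono (hsf m)
  -- With `N` fixed, the finite product is continuous and decreasing along the simple
  -- approximations.
  have hstep : ∀ N, ∫⁻ ω, ∏ i ∈ Finset.range N, (1 - f (X i ω)) ∂P =
      ⨅ m, ∫⁻ ω, ∏ i ∈ Finset.range N, (1 - s m (X i ω)) ∂P := by
    intro N
    have hanti : ∀ ω, Antitone fun m => ∏ i ∈ Finset.range N, (1 - s m (X i ω)) :=
      fun ω m k hmk => Finset.prod_le_prod' fun i _ => tsub_le_tsub_left (hmono _ hmk) _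
    rw [← lintegral_iInf]
    · refine lintegral_congr fun ω => ?_
      refine tendsto_nhds_unique ?_ (tendsto_atTop_iInf (hanti ω))
      refine ENNReal.tendsto_finsetProd_of_ne_top _ (fun i _ => ?_) (fun i _ => ?_)
      · exact ENNReal.Tendsto.sub tendsto_const_nhds (hlim _) (.inl ENNReal.one_ne_top)
      · exact ne_top_of_le_ne_top ENNReal.one_ne_top tsub_le_self
    · exact fun m => Finset.measurable_prod _ fun i _ =>
        ((s m).measurable.comp (hX.measurable i)).const_sub 1
    · exact fun m k hmk ω => hanti ω hmk
    · refine ne_top_of_le_ne_top (b := 1) ENNReal.one_ne_top ?_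
      calc _ ≤ ∫⁻ _, 1 ∂P := lintegral_mono fun ω => Finset.prod_le_one' fun i _ => tsub_le_self
        _ = 1 := by simp
  simp_rw [hstep]
  -- Exchanging the two infima leaves, for each `m`, the case of a simple function.
  rw [iInf_comm]
  have hm : ∀ m, ⨅ N, ∫⁻ ω, ∏ i ∈ Finset.range N, (1 - s m (X i ω)) ∂P =
      ENNReal.ofReal (Real.exp (-(∫⁻ y, s m y ∂Λ).toReal)) := fun m =>
    hX.iInf_lintegral_prod_simpleFunc (s m) (fun y => (hsf m y).trans (hf1 y))
      (ne_top_of_le_ne_top hint (hsint m))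
  simp_rw [hm]
  have hconv : Filter.Tendsto (fun m => ∫⁻ y, s m y ∂Λ) Filter.atTop (nhds (∫⁻ y, f y ∂Λ)) :=
    lintegral_tendsto_of_tendsto_of_monotone (fun m => (s m).measurable.aemeasurable)
      (.of_forall hmono) (.of_forall hlim)
  have hconv2 := ENNReal.tendsto_ofReal (Real.continuous_exp.continuousAt.tendsto.comp
    ((ENNReal.tendsto_toReal hint).comp hconv).neg)
  refine tendsto_nhds_unique (tendsto_atTop_iInf fun m k hmk => ?_) hconv2
  refine ENNReal.ofReal_le_ofReal (Real.exp_le_exp.2 (neg_le_neg ?_))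
  exact ENNReal.toReal_mono (ne_top_of_le_ne_top hint (hsint k))
    (lintegral_mono fun y => hmono y hmk)

end IsPoissonPointProcess

/-! ### The standard complex Gaussian and its unitary invariance -/

lemma measurable_complex_mk : Measurable fun p : ℝ × ℝ => (⟨p.1, p.2⟩ : ℂ) :=
  Complex.measurableEquivRealProd.symm.measurable

instance : IsProbabilityMeasure stdComplexGaussian :=
  Measure.isProbabilityMeasure_map measurable_complex_mk.aemeasurable

lemma lintegral_stdComplexGaussian {f : ℂ → ℝ≥0∞} (hf : Measurable f) :
    ∫⁻ z, f z ∂stdComplexGaussian =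
      ∫⁻ z : ℂ, ENNReal.ofReal (Real.pi⁻¹ * Real.exp (-‖z‖ ^ 2)) * f z := by
  have h2 : (1 / 2 : ℝ≥0) ≠ 0 := by norm_num
  rw [stdComplexGaussian, lintegral_map hf measurable_complex_mk,
    gaussianReal_of_var_ne_zero _ h2,
    prod_withDensity (measurable_gaussianPDF _ _) (measurable_gaussianPDF _ _),
    lintegral_withDensity_eq_lintegral_mul _ (by fun_prop)
      (f := fun z => gaussianPDF 0 (1 / 2) z.1 * gaussianPDF 0 (1 / 2) z.2)
      (g := fun p : ℝ × ℝ => f ⟨p.1, p.2⟩) (hf.comp measurable_complex_mk),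
    ← Measure.volume_eq_prod,
    ← Complex.volume_preserving_equiv_real_prod.symm.lintegral_comp_emb
      Complex.measurableEquivRealProd.symm.measurableEmbedding]
  refine lintegral_congr fun p => ?_
  simp only [Pi.mul_apply]
  congr 1
  rw [gaussianPDF, gaussianPDF, ← ENNReal.ofReal_mul (gaussianPDFReal_nonneg _ _ _)]
  congr 1
  have hn : ‖Complex.measurableEquivRealProd.symm p‖ ^ 2 = p.1 ^ 2 + p.2 ^ 2 := by
    rw [← Complex.normSq_eq_norm_sq, Complex.normSq_apply]
    simp only [Complex.measurableEquivRealProd_symm_apply]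
    ring
  rw [hn, gaussianPDFReal, gaussianPDFReal]
  have hs : (2 * Real.pi * ((1 / 2 : ℝ≥0) : ℝ)) = Real.pi := by
    push_cast
    ring
  rw [hs, mul_mul_mul_comm, ← Real.exp_add, ← mul_inv, Real.mul_self_sqrt Real.pi_pos.le]
  congr 2
  push_cast
  ring

/-- The integrand merges with the density into a Gaussian of rate `1 + c`. This averages out one
coordinate of the artificial noise. -/
lemma lintegral_exp_neg_mul_stdComplexGaussian {c : ℝ} (hc : 0 ≤ c) :
    ∫⁻ z, ENNReal.ofReal (Real.exp (-(c * ‖z‖ ^ 2))) ∂stdComplexGaussian =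
      ENNReal.ofReal (1 + c)⁻¹ := by
  rw [lintegral_stdComplexGaussian (by fun_prop)]
  have hc1 : 0 < 1 + c := by linarith
  have hI := Complex.integral_exp_neg_mul_rpow (p := 2) (by norm_num) hc1
  rw [show (2 : ℝ) / 2 + 1 = 2 by norm_num, Real.Gamma_two, mul_one,
    show (-2 : ℝ) / 2 = -1 by norm_num, Real.rpow_neg_one] at hI
  -- Otherwise the Bochner integral would be `0` by convention, against the positive closed form.
  have hint : Integrable fun x : ℂ => Real.exp (-(1 + c) * ‖x‖ ^ (2 : ℝ)) := by
    by_contra h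
    rw [integral_undef h] at hI
    have : 0 < Real.pi * (1 + c)⁻¹ := by positivity
    linarith
  have hcongr : ∀ z : ℂ, ENNReal.ofReal (Real.pi⁻¹ * Real.exp (-‖z‖ ^ 2)) *
      ENNReal.ofReal (Real.exp (-(c * ‖z‖ ^ 2))) =
      ENNReal.ofReal (Real.pi⁻¹ * Real.exp (-(1 + c) * ‖z‖ ^ (2 : ℝ))) := by
    intro z
    rw [← ENNReal.ofReal_mul (by positivity), mul_assoc, ← Real.exp_add, Real.rpow_two]
    congr 3
    ring
  simp_rw [hcongr]
  rw [← ofReal_integral_eq_lintegral_ofReal (hint.const_mul _)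
    (.of_forall fun _ => by positivity), integral_const_mul, hI, ← mul_assoc,
    inv_mul_cancel₀ Real.pi_ne_zero, one_mul]

lemma lintegral_Ioi_mul_exp_neg_sq {a : ℝ} (ha : 0 ≤ a) :
    ∫⁻ r in Set.Ioi a, ENNReal.ofReal (2 * r * Real.exp (-r ^ 2)) =
      ENNReal.ofReal (Real.exp (-a ^ 2)) := by
  have hderiv : ∀ r ∈ Set.Ioi a,
      HasDerivAt (fun r => -Real.exp (-r ^ 2)) (2 * r * Real.exp (-r ^ 2)) r := by
    intro r _
    have := (((hasDerivAt_id r).pow 2).neg.exp).neg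
    refine this.congr_deriv ?_
    simp
    ring
  have hcont : ContinuousWithinAt (fun r => -Real.exp (-r ^ 2)) (Set.Ici a) a := by
    fun_prop
  have hpos : ∀ r ∈ Set.Ioi a, 0 ≤ 2 * r * Real.exp (-r ^ 2) := fun r hr => by
    have : 0 ≤ r := ha.trans (le_of_lt hr)
    positivity
  have hlim : Filter.Tendsto (fun r : ℝ => -Real.exp (-r ^ 2)) Filter.atTop (nhds 0) := by
    rw [← neg_zero]
    exact (Real.tendsto_exp_neg_atTop_nhds_zero.comp (Filter.tendsto_pow_atTop two_ne_zero)).neg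
  have hint := integrableOn_Ioi_deriv_of_nonneg hcont hderiv hpos hlim
  rw [← ofReal_integral_eq_lintegral_ofReal hint
    ((ae_restrict_iff' measurableSet_Ioi).2 (.of_forall hpos)),
    integral_Ioi_of_hasDerivAt_of_nonneg hcont hderiv hpos hlim]
  simp

/-- The squared modulus of a standard complex Gaussian is exponentially distributed. -/
lemma stdComplexGaussian_lt_norm_sq {s : ℝ} (hs : 0 ≤ s) :
    stdComplexGaussian {z | s < ‖z‖ ^ 2} = ENNReal.ofReal (Real.exp (-s)) := by
  have hm : MeasurableSet {z : ℂ | s < ‖z‖ ^ 2} :=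
    measurableSet_lt measurable_const (by fun_prop)
  rw [← lintegral_indicator_one hm, lintegral_stdComplexGaussian (measurable_one.indicator hm),
    ← Complex.lintegral_comp_polarCoord_symm, polarCoord_target, Measure.volume_eq_prod,
    ← Measure.prod_restrict]
  -- The radial factor in polar coordinates; the angle contributes `2π`, which turns `π⁻¹ * r` into
  -- `2 * r`.
  set g : ℝ → ℝ≥0∞ := fun r => (Set.Ioi √s).indicator
    (fun r => ENNReal.ofReal (Real.pi⁻¹ * r * Real.exp (-r ^ 2))) r
  have hg : Measurable g := Measurable.indicator (by fun_prop) measurableSet_Ioi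
  have hcongr : ∀ᵐ p ∂((volume.restrict (Set.Ioi (0 : ℝ))).prod
      (volume.restrict (Set.Ioo (-Real.pi) Real.pi))),
      ENNReal.ofReal p.1 • (ENNReal.ofReal
        (Real.pi⁻¹ * Real.exp (-‖Complex.polarCoord.symm p‖ ^ 2)) *
        {z : ℂ | s < ‖z‖ ^ 2}.indicator 1 (Complex.polarCoord.symm p)) = g p.1 * 1 := by
    have h1 : ∀ᵐ p ∂((volume.restrict (Set.Ioi (0 : ℝ))).prod
      (volume.restrict (Set.Ioo (-Real.pi) Real.pi))), p.1 ∈ Set.Ioi (0 : ℝ) :=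
      Measure.quasiMeasurePreserving_fst.ae (ae_restrict_mem measurableSet_Ioi)
    filter_upwards [h1] with p hp
    have hp0 : 0 < p.1 := hp
    have hiff : s < p.1 ^ 2 ↔ √s < p.1 := (Real.sqrt_lt hs hp0.le).symm
    simp only [Set.indicator, Set.mem_ofPred_eq, Complex.norm_polarCoord_symm, sq_abs, hiff,
      Set.mem_Ioi, g]
    split_ifs
    · rw [smul_eq_mul, Pi.one_apply, mul_one, mul_one, ← ENNReal.ofReal_mul hp0.le]
      congr 1
      ring
    · simp
  rw [lintegral_congr_ae hcongr, lintegral_prod_mul hg.aemeasurable aemeasurable_const,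
    lintegral_one, Measure.restrict_apply_univ, Real.volume_Ioo, lintegral_indicator
    measurableSet_Ioi, Measure.restrict_restrict measurableSet_Ioi,
    Set.inter_eq_self_of_subset_left (Set.Ioi_subset_Ioi (Real.sqrt_nonneg s)),
    ← lintegral_mul_const _ (by fun_prop)]
  -- Writing `s` as `√s ^ 2` brings the right side to the radial tail formula with endpoint `√s`.
  rw [← Real.sq_sqrt hs, Real.sqrt_sq (Real.sqrt_nonneg s),
    ← lintegral_Ioi_mul_exp_neg_sq (Real.sqrt_nonneg s)]
  refine setLIntegral_congr_fun measurableSet_Ioi fun r hr => ?_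
  have hr0 : 0 ≤ r := (Real.sqrt_nonneg s).trans (le_of_lt hr)
  rw [← ENNReal.ofReal_mul (by positivity)]
  congr 1
  field_simp [Real.pi_ne_zero]
  ring

lemma charFun_stdComplexGaussian (t : ℂ) :
    charFun stdComplexGaussian t = Complex.exp (-‖t‖ ^ 2 / 4) := by
  rw [charFun_apply, stdComplexGaussian, integral_map measurable_complex_mk.aemeasurable
    (by fun_prop)]
  have h : ∀ p : ℝ × ℝ, Complex.exp (((inner ℝ (⟨p.1, p.2⟩ : ℂ) t : ℝ) : ℂ) * Complex.I) =
      Complex.exp (t.re * p.1 * Complex.I) * Complex.exp (t.im * p.2 * Complex.I) := by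
    intro p
    rw [← Complex.exp_add, Complex.inner]
    congr 1
    simp
    ring
  simp_rw [h]
  rw [integral_prod_mul (fun x : ℝ => Complex.exp (t.re * x * Complex.I))
    (fun x : ℝ => Complex.exp (t.im * x * Complex.I)), ← charFun_apply_real, ← charFun_apply_real,
    charFun_gaussianReal, charFun_gaussianReal, ← Complex.exp_add]
  congr 1
  rw [← Complex.ofReal_pow ‖t‖, ← Complex.normSq_eq_norm_sq, Complex.normSq_apply]
  push_cast
  ring

/-- Only the norm of `t` enters, which is what forces invariance under isometries. -/
lemma charFun_pi_stdComplexGaussian {ι : Type*} [Fintype ι] (t : EuclideanSpace ℂ ι) :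
    charFun ((Measure.pi fun _ : ι => stdComplexGaussian).map (WithLp.toLp 2)) t =
      Complex.exp (-‖t‖ ^ 2 / 4) := by
  rw [charFun_pi (E := fun _ : ι => ℂ)]
  simp_rw [charFun_stdComplexGaussian]
  rw [← Complex.exp_sum, ← Complex.ofReal_pow, EuclideanSpace.norm_sq_eq]
  push_cast
  rw [← Finset.sum_div, Finset.sum_neg_distrib]

/-- Unitary invariance of the standard complex Gaussian vector. -/
lemma pi_stdComplexGaussian_map_isometry {ι κ : Type*} [Fintype ι] [Fintype κ]
    (T : EuclideanSpace ℂ ι ≃ₗᵢ[ℂ] EuclideanSpace ℂ κ) :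
    (Measure.pi fun _ : ι => stdComplexGaussian).map
        (fun v => (T (WithLp.toLp 2 v)).ofLp) =
      Measure.pi fun _ : κ => stdComplexGaussian := by
  -- Characteristic functions use the real inner product, so `T` is viewed as a real isometry.
  let S : EuclideanSpace ℂ ι ≃ₗᵢ[ℝ] EuclideanSpace ℂ κ :=
    ⟨T.toLinearEquiv.restrictScalars ℝ, T.norm_map⟩
  have hS : Measurable fun v : ι → ℂ => S (WithLp.toLp 2 v) :=
    S.continuous.measurable.comp (WithLp.measurable_toLp 2 _)
  refine (MeasurableEquiv.toLp 2 (κ → ℂ)).map_measurableEquiv_injective ?_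
  have hcomp : (fun v : ι → ℂ => S (WithLp.toLp 2 v)) = S ∘ WithLp.toLp 2 := rfl
  have hT : Measurable fun v : ι → ℂ => (T (WithLp.toLp 2 v)).ofLp :=
    (WithLp.measurable_ofLp 2 _).comp hS
  rw [Measure.map_map (MeasurableEquiv.measurable _) hT, MeasurableEquiv.coe_toLp]
  change Measure.map (fun v => S (WithLp.toLp 2 v)) _ = _
  have : IsProbabilityMeasure ((Measure.pi fun _ : ι => stdComplexGaussian).map
      (fun v => S (WithLp.toLp 2 v))) := Measure.isProbabilityMeasure_map hS.aemeasurable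
  have : IsProbabilityMeasure ((Measure.pi fun _ : κ => stdComplexGaussian).map
      (WithLp.toLp 2)) :=
    Measure.isProbabilityMeasure_map (WithLp.measurable_toLp 2 _).aemeasurable
  refine Measure.ext_of_charFun (funext fun t => ?_)
  rw [charFun_pi_stdComplexGaussian, hcomp,
    ← Measure.map_map S.continuous.measurable (WithLp.measurable_toLp 2 _), charFun_apply,
    integral_map S.continuous.measurable.aemeasurable (by fun_prop)]
  have hin : ∀ x, inner ℝ (S x) t = inner ℝ x (S.symm t) := fun x => by
    rw [← S.inner_map_map, S.apply_symm_apply]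
  simp_rw [hin]
  rw [← charFun_apply, charFun_pi_stdComplexGaussian, S.symm.norm_map]

lemma lintegral_pi_prod {ι E : Type*} [Fintype ι] [MeasurableSpace E] (μ : Measure E)
    [IsProbabilityMeasure μ] {f : E → ℝ≥0∞} (hf : Measurable f) :
    ∫⁻ y, ∏ j, f (y j) ∂(Measure.pi fun _ : ι => μ) = (∫⁻ z, f z ∂μ) ^ Fintype.card ι := by
  have hind : iIndepFun (fun (j : ι) (y : ι → E) => f (y j)) (Measure.pi fun _ : ι => μ) :=
    iIndepFun_pi (X := fun _ => f) fun _ => hf.aemeasurable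
  have h := lintegral_prod_eq_prod_lintegral_of_indepFun Finset.univ _ hind
    fun j => hf.comp (measurable_pi_apply j)
  rw [h, ← Finset.card_univ, ← Finset.prod_const]
  exact Finset.prod_congr rfl fun j _ =>
    (measurePreserving_eval (fun _ : ι => μ) j).lintegral_comp hf

/-! ### The SINR tail at a fixed distance -/

lemma l2norm_sq {m : ℕ} (v : Fin m → ℂ) : l2norm v ^ 2 = ∑ j, ‖v j‖ ^ 2 := by
  rw [l2norm, EuclideanSpace.norm_sq_eq]

lemma measurable_l2norm {m : ℕ} : Measurable (l2norm : (Fin m → ℂ) → ℝ) :=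
  (WithLp.measurable_toLp 2 _).norm

lemma measurable_mrtBeamformer {n : ℕ} :
    Measurable (mrtBeamformer : (Fin n → ℂ) → Fin n → ℂ) := by
  refine measurable_pi_lambda _ fun k => ?_
  have h1 : Measurable fun g : Fin n → ℂ => star (g k) :=
    continuous_star.measurable.comp (measurable_pi_apply k)
  exact h1.div (Complex.measurable_ofReal.comp measurable_l2norm)

lemma measurable_eveSINR {α : Type*} [MeasurableSpace α] {n : ℕ} (ζ Ps σn η : ℝ)
    {w : α → Fin n → ℂ} {G : α → Matrix (Fin n) (Fin (n - 1)) ℂ} {r : α → ℝ}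
    {h : α → Fin n → ℂ} (hw : Measurable w) (hG : Measurable fun a k j => G a k j)
    (hr : Measurable r) (hh : Measurable h) :
    Measurable fun a => eveSINR ζ Ps σn η (w a) (G a) (r a) (h a) := by
  have hw' : ∀ k, Measurable fun a => w a k := fun k => (measurable_pi_apply k).comp hw
  have hh' : ∀ k, Measurable fun a => h a k := fun k => (measurable_pi_apply k).comp hh
  have hG' : ∀ k j, Measurable fun a => G a k j := fun k j =>
    (measurable_pi_apply j).comp ((measurable_pi_apply k).comp hG)
  have h1 : Measurable fun a => w a ⬝ᵥ h a :=
    Finset.measurable_sum _ fun k _ => (hw' k).mul (hh' k)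
  have h2 : Measurable fun a => l2norm (Matrix.vecMul (h a) (G a)) :=
    measurable_l2norm.comp (measurable_pi_lambda _ fun j => by
      simp only [Matrix.vecMul, dotProduct]
      exact Finset.measurable_sum _ fun k _ => (hh' k).mul (hG' k j))
  unfold eveSINR
  fun_prop

/-- The product `w ⬝ᵥ v` carries no conjugation, so it is the inner product of `v` with the
conjugate of `w`. The conjugated family is again orthonormal and has `n` members; `T` takes
coordinates in this basis. -/
lemma IsCompletedBy.exists_isometry {n : ℕ} (hn : 1 ≤ n) {w : Fin n → ℂ}
    {G : Matrix (Fin n) (Fin (n - 1)) ℂ} (h : IsCompletedBy w G) :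
    ∃ T : EuclideanSpace ℂ (Fin n) ≃ₗᵢ[ℂ] EuclideanSpace ℂ (Option (Fin (n - 1))),
      ∀ v : Fin n → ℂ, T (WithLp.toLp 2 v) none = w ⬝ᵥ v ∧
        ∀ j, T (WithLp.toLp 2 v) (some j) = Matrix.vecMul v G j := by
  set u : Option (Fin (n - 1)) → EuclideanSpace ℂ (Fin n) := fun o =>
    WithLp.toLp 2 (star (o.elim w (fun j k => G k j))) with hu
  have hon : Orthonormal ℂ u := by
    rw [IsCompletedBy, orthonormal_iff_ite] at h
    rw [orthonormal_iff_ite]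
    intro a b
    -- Conjugating both vectors swaps the arguments of the inner product.
    have hab := h b a
    rw [EuclideanSpace.inner_toLp_toLp] at hab ⊢
    rw [star_star, dotProduct_comm, hab]
    simp [eq_comm]
  have hcard : Fintype.card (Option (Fin (n - 1))) =
      Module.finrank ℂ (EuclideanSpace ℂ (Fin n)) := by
    simp
    omega
  have hspan : ⊤ ≤ Submodule.span ℂ (Set.range u) := by
    rw [← coe_basisOfOrthonormalOfCardEqFinrank hon hcard]
    exact (Module.Basis.span_eq _).ge
  refine ⟨(OrthonormalBasis.mk hon hspan).repr, fun v => ⟨?_, fun j => ?_⟩⟩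
  · rw [OrthonormalBasis.repr_apply_apply, OrthonormalBasis.coe_mk, hu]
    simp [EuclideanSpace.inner_toLp_toLp, dotProduct_comm]
  · rw [OrthonormalBasis.repr_apply_apply, OrthonormalBasis.coe_mk, hu]
    simp [EuclideanSpace.inner_toLp_toLp, Matrix.vecMul, dotProduct, mul_comm]

/-- Given the noise coordinates, the exponential tail of `‖z none‖ ^ 2` factors over them, and each
coordinate then integrates to `(1 + c)⁻¹`. -/
lemma pi_option_stdComplexGaussian_lt {m : ℕ} {c s : ℝ} (hc : 0 ≤ c) (hs : 0 ≤ s) :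
    (Measure.pi fun _ : Option (Fin m) => stdComplexGaussian)
        {z | c * ∑ j, ‖z (some j)‖ ^ 2 + s < ‖z none‖ ^ 2} =
      ENNReal.ofReal (Real.exp (-s) * ((1 + c)⁻¹) ^ m) := by
  have hm : MeasurableSet {z : Option (Fin m) → ℂ |
      c * ∑ j, ‖z (some j)‖ ^ 2 + s < ‖z none‖ ^ 2} :=
    measurableSet_lt (by fun_prop) (by fun_prop)
  rw [← Measure.pi_map_piOptionEquivProd (fun _ : Option (Fin m) => stdComplexGaussian),
    Measure.map_apply (MeasurableEquiv.measurable _) hm,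
    Measure.prod_apply (MeasurableEquiv.measurable _ hm)]
  have hsec : ∀ y : Fin m → ℂ, stdComplexGaussian (Prod.mk y ⁻¹'
      ((MeasurableEquiv.piOptionEquivProd fun _ : Option (Fin m) => ℂ).symm ⁻¹'
        {z | c * ∑ j, ‖z (some j)‖ ^ 2 + s < ‖z none‖ ^ 2})) =
      ENNReal.ofReal (Real.exp (-s)) * ∏ j, ENNReal.ofReal (Real.exp (-(c * ‖y j‖ ^ 2))) := by
    intro y
    have : 0 ≤ c * ∑ j, ‖y j‖ ^ 2 := mul_nonneg hc (Finset.sum_nonneg fun _ _ => sq_nonneg _)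
    rw [← ENNReal.ofReal_prod_of_nonneg fun _ _ => (Real.exp_pos _).le, ← Real.exp_sum,
      ← ENNReal.ofReal_mul (Real.exp_pos _).le, ← Real.exp_add]
    refine Eq.trans ?_ ((stdComplexGaussian_lt_norm_sq (add_nonneg this hs)).trans ?_)
    · rfl
    · rw [Finset.sum_neg_distrib, ← Finset.mul_sum, neg_add_rev]
  simp_rw [hsec]
  rw [lintegral_const_mul _ (by fun_prop), lintegral_pi_prod stdComplexGaussian
    (f := fun z => ENNReal.ofReal (Real.exp (-(c * ‖z‖ ^ 2)))) (by fun_prop),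
    lintegral_exp_neg_mul_stdComplexGaussian hc, Fintype.card_fin,
    ← ENNReal.ofReal_pow (by positivity), ← ENNReal.ofReal_mul (Real.exp_pos _).le]

/-- The tail of the SINR at an eavesdropper at a fixed distance. -/
lemma pi_stdComplexGaussian_lt_eveSINR {n : ℕ} (hn : 2 ≤ n) {ζ Ps σn η : ℝ} (hPs : 0 < Ps)
    (hσ : 0 < σn) (hζ0 : 0 < ζ) (hζ1 : ζ ≤ 1) {w : Fin n → ℂ}
    {G : Matrix (Fin n) (Fin (n - 1)) ℂ} (hG : IsCompletedBy w G) {r x : ℝ} (hr : 0 < r)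
    (hx : 0 ≤ x) :
    (Measure.pi fun _ : Fin n => stdComplexGaussian) {v | x < eveSINR ζ Ps σn η w G r v} =
      ENNReal.ofReal (Real.exp (-(x * σn / (ζ * Ps) * r ^ η)) *
        (1 + (1 / ζ - 1) / ((n : ℝ) - 1) * x) ^ (1 - (n : ℝ))) := by
  obtain ⟨T, hT⟩ := hG.exists_isometry (by omega)
  have hn1 : 0 < (n : ℝ) - 1 := by
    have : (2 : ℝ) ≤ n := by exact_mod_cast hn
    linarith
  have hζ : 0 ≤ 1 / ζ - 1 := by
    rw [sub_nonneg, le_div_iff₀ hζ0]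
    linarith
  have hc : 0 ≤ (1 / ζ - 1) / ((n : ℝ) - 1) * x := by positivity
  have hs : 0 ≤ x * σn / (ζ * Ps) * r ^ η := by positivity
  have hTm : Measurable fun v : Fin n → ℂ => (T (WithLp.toLp 2 v)).ofLp :=
    (WithLp.measurable_ofLp 2 _).comp
      (T.continuous.measurable.comp (WithLp.measurable_toLp 2 _))
  have hm : MeasurableSet {z : Option (Fin (n - 1)) → ℂ |
      (1 / ζ - 1) / ((n : ℝ) - 1) * x * ∑ j, ‖z (some j)‖ ^ 2 + x * σn / (ζ * Ps) * r ^ η <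
        ‖z none‖ ^ 2} :=
    measurableSet_lt (by fun_prop) (by fun_prop)
  have hpow : (1 + (1 / ζ - 1) / ((n : ℝ) - 1) * x) ^ (1 - (n : ℝ)) =
      ((1 + (1 / ζ - 1) / ((n : ℝ) - 1) * x)⁻¹) ^ (n - 1) := by
    rw [inv_pow, ← Real.rpow_natCast, ← Real.rpow_neg (by positivity), Nat.cast_sub (by omega),
      Nat.cast_one, neg_sub]
  rw [hpow, ← pi_option_stdComplexGaussian_lt hc hs, ← pi_stdComplexGaussian_map_isometry T,
    Measure.map_apply hTm hm]
  congr 1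
  ext v
  simp only [Set.mem_ofPred_eq, Set.mem_preimage, (hT v).1, (hT v).2, eveSINR]
  rw [← l2norm_sq (Matrix.vecMul v G)]
  set S := l2norm (Matrix.vecMul v G) ^ 2 with hS
  have hS0 : 0 ≤ S := sq_nonneg _
  have hrη : 0 < r ^ η := Real.rpow_pos_of_pos hr _
  have hζ1' : 0 ≤ 1 - ζ := by linarith
  rw [Real.rpow_neg hr.le, lt_div_iff₀ (by positivity)]
  have hk : 0 < r ^ η / (ζ * Ps) := by positivity
  -- Multiplying by `r ^ η / (ζ * Ps)` isolates `‖w ⬝ᵥ v‖ ^ 2` and exhibits the constants `c` and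
  -- `s` of the Gaussian computation.
  rw [← mul_lt_mul_iff_left₀ hk]
  have e1 : x * ((1 - ζ) * Ps * S * (r ^ η)⁻¹ / ((n : ℝ) - 1) + σn) * (r ^ η / (ζ * Ps)) =
      (1 / ζ - 1) / ((n : ℝ) - 1) * x * S + x * σn / (ζ * Ps) * r ^ η := by
    field_simp
  have e2 : ζ * Ps * (r ^ η)⁻¹ * ‖w ⬝ᵥ v‖ ^ 2 * (r ^ η / (ζ * Ps)) = ‖w ⬝ᵥ v‖ ^ 2 := by
    field_simp
  rw [e1, e2]

/-! ### The integral over the plane, conditioning, and attained suprema -/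

lemma lintegral_plane_exp_neg_mul_rpow {a η : ℝ} (ha : 0 < a) (hη : 1 ≤ η) :
    ∫⁻ y : Plane, ENNReal.ofReal (Real.exp (-(a * ‖y‖ ^ η))) =
      ENNReal.ofReal (Real.pi * a ^ (-(2 / η)) * Real.Gamma (1 + 2 / η)) := by
  have hmp := Complex.orthonormalBasisOneI.measurePreserving_repr
  rw [← hmp.lintegral_comp (by fun_prop)]
  simp only [LinearIsometryEquiv.norm_map]
  have hI := Complex.integral_exp_neg_mul_rpow hη ha
  rw [neg_div, add_comm (2 / η) 1] at hI
  have hint : Integrable fun x : ℂ => Real.exp (-a * ‖x‖ ^ η) := by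
    by_contra h
    rw [integral_undef h] at hI
    have : 0 < Real.pi * a ^ (-(2 / η)) * Real.Gamma (1 + 2 / η) := by
      have : 0 < Real.Gamma (1 + 2 / η) := Real.Gamma_pos_of_pos (by positivity)
      positivity
    linarith
  rw [← hI, ofReal_integral_eq_lintegral_ofReal hint (.of_forall fun _ => (Real.exp_pos _).le)]
  simp only [neg_mul]

/-- Independent variables with a common law stay so conditionally on an independent variable `Y`. -/
lemma measure_forall_mem_of_indepFun {Ω E F : Type*} [MeasurableSpace Ω] [MeasurableSpace E]
    [MeasurableSpace F] {P : Measure Ω} [IsProbabilityMeasure P] {μ : Measure E}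
    [IsProbabilityMeasure μ] {h : ℕ → Ω → E} {Y : Ω → F} (hh : ∀ i, HasLaw (h i) μ P)
    (hmeas : ∀ i, Measurable (h i)) (hind : iIndepFun h P) (hY : Measurable Y)
    (hhY : IndepFun (fun ω i => h i ω) Y P) {A : ℕ → Set (F × E)}
    (hA : ∀ i, MeasurableSet (A i)) (s : Finset ℕ) :
    P {ω | ∀ i ∈ s, (Y ω, h i ω) ∈ A i} =
      ∫⁻ ω, ∏ i ∈ s, μ (Prod.mk (Y ω) ⁻¹' A i) ∂P := by
  have hlaw : HasLaw (fun ω (i : s) => h i ω) (Measure.pi fun _ : s => μ) P :=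
    (hind.precomp Subtype.val_injective).hasLaw_pi fun i : s => hh i
  have hHm : Measurable fun ω (i : s) => h i ω := measurable_pi_lambda _ fun i => hmeas i
  have hindY : IndepFun Y (fun ω (i : s) => h i ω) P :=
    (hhY.comp (φ := fun (v : ℕ → E) (i : s) => v i) (ψ := id)
      (measurable_pi_lambda _ fun i => measurable_pi_apply _) measurable_id).symm
  have hjoint := hindY.map_prod_eq_prod_map_map hY.aemeasurable hHm.aemeasurable
  rw [hlaw.map_eq] at hjoint
  set B : Set (F × (s → E)) := ⋂ i : s, (fun p : F × (s → E) => (p.1, p.2 i)) ⁻¹' A i with hB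
  have hBm : MeasurableSet B := MeasurableSet.iInter fun i => by
    refine measurableSet_preimage ?_ (hA i)
    fun_prop
  have hset : {ω | ∀ i ∈ s, (Y ω, h i ω) ∈ A i} =
      (fun ω => (Y ω, fun i : s => h i ω)) ⁻¹' B := by
    ext ω
    simp [hB]
  rw [hset, ← Measure.map_apply (hY.prodMk hHm) hBm, hjoint, Measure.prod_apply hBm,
    lintegral_map (measurable_measure_prodMk_left hBm) hY]
  refine lintegral_congr fun ω => ?_
  -- For a fixed value of `Y` the event is a box, so the product measure factors.
  have hsec : Prod.mk (Y ω) ⁻¹' B = Set.univ.pi fun i : s => Prod.mk (Y ω) ⁻¹' A i := by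
    ext v
    simp [hB]
  rw [hsec, Measure.pi_pi, Finset.prod_coe_sort s fun i => μ (Prod.mk (Y ω) ⁻¹' A i)]

/-- The mean measure does not charge the origin. The tail formula for the SINR asks for a positive
distance. -/
lemma IsPoissonPointProcess.ae_ne_zero {Ω : Type*} [MeasurableSpace Ω] {P : Measure Ω} {c : ℝ≥0∞}
    {X : ℕ → Ω → Plane} (hX : IsPoissonPointProcess P (c • volume) X) (i : ℕ) :
    ∀ᵐ ω ∂P, X i ω ≠ 0 := by
  have h : P.map (X i) {0} ≤ (c • volume : Measure Plane) {0} :=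
    (Measure.le_iff'.1 (Measure.le_sum (fun i => P.map (X i)) i) _).trans
      (Measure.le_iff'.1 hX.sum_map_le _)
  rw [Measure.map_apply (hX.measurable i) (measurableSet_singleton 0)] at h
  simp only [Measure.smul_apply, measure_singleton, smul_zero, nonpos_iff_eq_zero] at h
  exact measure_eq_zero_iff_ae_notMem.1 h

lemma exists_isGreatest_range_of_finite {u : ℕ → ℝ} {y : ℝ} {j : ℕ} (hj : y < u j)
    (hfin : {i | y < u i}.Finite) : ∃ i, IsGreatest (Set.range u) (u i) := by
  obtain ⟨i, _, himax⟩ := hfin.exists_maximalFor u _ ⟨j, hj⟩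
  refine ⟨i, ⟨i, rfl⟩, ?_⟩
  have hji : u j ≤ u i := (le_total (u j) (u i)).elim id (himax hj)
  rintro _ ⟨k, rfl⟩
  rcases lt_or_ge y (u k) with hk | hk
  · exact (le_total (u k) (u i)).elim id (himax hk)
  · exact hk.trans (hj.le.trans hji)

/-- The conditional probability that an eavesdropper located at `y` has SINR above `x`. -/
noncomputable def sinrTail (n : ℕ) (ζ Ps σn η x : ℝ) (y : Plane) : ℝ≥0∞ :=
  ENNReal.ofReal (Real.exp (-(x * σn / (ζ * Ps) * ‖y‖ ^ η)) *
    (1 + (1 / ζ - 1) / ((n : ℝ) - 1) * x) ^ (1 - (n : ℝ)))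

lemma measurable_sinrTail (n : ℕ) (ζ Ps σn η x : ℝ) : Measurable (sinrTail n ζ Ps σn η x) := by
  unfold sinrTail
  fun_prop

lemma sinrTail_le_one {n : ℕ} (hn : 2 ≤ n) {ζ Ps σn η x : ℝ} (hPs : 0 < Ps) (hσ : 0 < σn)
    (hζ0 : 0 < ζ) (hζ1 : ζ ≤ 1) (hx : 0 ≤ x) (y : Plane) : sinrTail n ζ Ps σn η x y ≤ 1 := by
  have hn1 : 1 ≤ (n : ℝ) - 1 := by
    have : (2 : ℝ) ≤ n := by exact_mod_cast hn
    linarith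
  have hζ : 0 ≤ 1 / ζ - 1 := by
    rw [sub_nonneg, le_div_iff₀ hζ0]
    linarith
  have hc : 0 ≤ (1 / ζ - 1) / ((n : ℝ) - 1) * x := by positivity
  have hs : 0 ≤ x * σn / (ζ * Ps) * ‖y‖ ^ η := by positivity
  refine ENNReal.ofReal_le_one.2 (mul_le_one₀ (Real.exp_le_one_iff.2 (by linarith))
    (by positivity) (Real.rpow_le_one_of_one_le_of_nonpos (by linarith) (by linarith)))

/-- The finiteness of this integral yields the existence of the maximum, and its value is the
exponent in the CDF. -/
lemma lintegral_sinrTail {n : ℕ} {lamE ζ Ps σn η x : ℝ} (hlam : 0 < lamE)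
    (hPs : 0 < Ps) (hσ : 0 < σn) (hζ0 : 0 < ζ) (hη : 2 < η) (hx : 0 < x) :
    ∫⁻ y, sinrTail n ζ Ps σn η x y ∂(ENNReal.ofReal lamE • volume) =
      ENNReal.ofReal (Real.pi * Real.Gamma (1 + 2 / η) * lamE * (ζ * (Ps / σn)) ^ (2 / η) *
        x ^ (-(2 / η)) * (1 + (1 / ζ - 1) / ((n : ℝ) - 1) * x) ^ (1 - (n : ℝ))) := by
  unfold sinrTail
  simp only [ENNReal.ofReal_mul (Real.exp_pos _).le]
  have hG : 0 < Real.Gamma (1 + 2 / η) := Real.Gamma_pos_of_pos (by positivity)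
  rw [lintegral_smul_measure, lintegral_mul_const _ (by fun_prop),
    lintegral_plane_exp_neg_mul_rpow (by positivity) (by linarith), smul_eq_mul,
    ← ENNReal.ofReal_mul (by positivity), ← ENNReal.ofReal_mul hlam.le]
  have ha : (x * σn / (ζ * Ps)) ^ (-(2 / η)) = (ζ * (Ps / σn)) ^ (2 / η) * x ^ (-(2 / η)) := by
    rw [show x * σn / (ζ * Ps) = (ζ * (Ps / σn))⁻¹ * x by field_simp,
      Real.mul_rpow (by positivity) hx.le, Real.inv_rpow (by positivity),
      Real.rpow_neg (by positivity), inv_inv]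
  rw [ha]
  congr 1
  ring

/-! ### The wiretap model: existence and law of the maximum -/

namespace IsWiretapModel

variable {Ω : Type*} [MeasurableSpace Ω] {P : Measure Ω} {n : ℕ}
  {lamE : ℝ} {X : ℕ → Ω → Plane} {h : ℕ → Ω → Fin n → ℂ} {hsd : Ω → Fin n → ℂ}
  {G : Ω → Matrix (Fin n) (Fin (n - 1)) ℂ}

lemma hasLaw_fading (hmodel : IsWiretapModel P n lamE X h hsd G) (i : ℕ) :
    HasLaw (h i) (Measure.pi fun _ : Fin n => stdComplexGaussian) P :=
  (hmodel.indep_h.precomp (g := fun k : Fin n => (i, k))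
    (Prod.mk_right_injective i)).hasLaw_pi fun k => hmodel.law_h i k

lemma measurable_sinrE (hmodel : IsWiretapModel P n lamE X h hsd G) (ζ Ps σn η : ℝ) (i : ℕ) :
    Measurable (sinrE ζ Ps σn η X h hsd G i) :=
  measurable_eveSINR ζ Ps σn η (measurable_mrtBeamformer.comp hmodel.measurable_hsd)
    hmodel.measurable_G (hmodel.poisson.measurable i).norm (hmodel.measurable_h i)

lemma ae_pi_lt_eveSINR (hmodel : IsWiretapModel P n lamE X h hsd G) (hn : 2 ≤ n)
    {ζ Ps σn : ℝ} (η : ℝ) (hPs : 0 < Ps) (hσ : 0 < σn) (hζ0 : 0 < ζ) (hζ1 : ζ ≤ 1) {x : ℝ}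
    (hx : 0 ≤ x) :
    ∀ᵐ ω ∂P, ∀ i, (Measure.pi fun _ : Fin n => stdComplexGaussian)
      {v | x < eveSINR ζ Ps σn η (mrtBeamformer (hsd ω)) (G ω) ‖X i ω‖ v} =
        sinrTail n ζ Ps σn η x (X i ω) := by
  filter_upwards [hmodel.basis, ae_all_iff.2 fun i => hmodel.poisson.ae_ne_zero i] with ω hω hX i
  exact pi_stdComplexGaussian_lt_eveSINR hn hPs hσ hζ0 hζ1 hω (norm_pos_iff.2 (hX i)) hx

variable [IsProbabilityMeasure P]

/-- The entries have an infinite product law over pairs; currying turns it into the product of the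
laws of the vectors. -/
lemma iIndepFun_fading (hmodel : IsWiretapModel P n lamE X h hsd G) : iIndepFun h P := by
  have hm : ∀ p : ℕ × Fin n, Measurable fun ω => h p.1 ω p.2 := fun p =>
    (measurable_pi_apply p.2).comp (hmodel.measurable_h p.1)
  have hjoint := hmodel.indep_h.hasLaw_infinitePi (μ := fun _ : ℕ × Fin n => stdComplexGaussian)
    (fun p => hmodel.law_h p.1 p.2) (measurable_pi_lambda _ hm).aemeasurable
  rw [iIndepFun_iff_hasLaw_Pi_infinitePi (fun i => hmodel.hasLaw_fading i)
    (measurable_pi_lambda _ hmodel.measurable_h).aemeasurable]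
  refine ⟨(measurable_pi_lambda _ hmodel.measurable_h).aemeasurable, ?_⟩
  have hc := Measure.infinitePi_map_curry (fun (_ : ℕ) (_ : Fin n) => stdComplexGaussian)
  rw [← hjoint.map_eq, Measure.map_map (MeasurableEquiv.measurable _)
    (measurable_pi_lambda _ hm)] at hc
  simp only [Measure.infinitePi_eq_pi] at hc
  exact hc

/-- Events about the SINRs of different eavesdroppers are conditionally independent given the
locations, the legitimate channel and the noise matrix. -/
lemma measure_forall_sinrE_mem (hmodel : IsWiretapModel P n lamE X h hsd G) (ζ Ps σn η : ℝ)
    {B : Set ℝ} (hB : MeasurableSet B) (s : Finset ℕ) :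
    P {ω | ∀ i ∈ s, sinrE ζ Ps σn η X h hsd G i ω ∈ B} =
      ∫⁻ ω, ∏ i ∈ s, (Measure.pi fun _ : Fin n => stdComplexGaussian)
        {v | eveSINR ζ Ps σn η (mrtBeamformer (hsd ω)) (G ω) ‖X i ω‖ v ∈ B} ∂P := by
  have hY : Measurable fun ω => ((fun i => X i ω), hsd ω, (fun k j => G ω k j)) :=
    (measurable_pi_lambda _ hmodel.poisson.measurable).prodMk
      (hmodel.measurable_hsd.prodMk hmodel.measurable_G)
  refine measure_forall_mem_of_indepFun hmodel.hasLaw_fading hmodel.measurable_h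
    hmodel.iIndepFun_fading hY hmodel.indep_links
    (A := fun i => {p | eveSINR ζ Ps σn η (mrtBeamformer p.1.2.1) (p.1.2.2) ‖p.1.1 i‖ p.2 ∈ B})
    (fun i => ?_) s
  refine (measurable_eveSINR ζ Ps σn η (measurable_mrtBeamformer.comp ?_) ?_ ?_ ?_) hB <;> fun_prop

lemma measure_lt_sinrE (hmodel : IsWiretapModel P n lamE X h hsd G) (hn : 2 ≤ n)
    {ζ Ps σn : ℝ} (η : ℝ) (hPs : 0 < Ps) (hσ : 0 < σn) (hζ0 : 0 < ζ) (hζ1 : ζ ≤ 1) {x : ℝ}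
    (hx : 0 ≤ x) (i : ℕ) :
    P {ω | x < sinrE ζ Ps σn η X h hsd G i ω} = ∫⁻ ω, sinrTail n ζ Ps σn η x (X i ω) ∂P := by
  have h1 := hmodel.measure_forall_sinrE_mem ζ Ps σn η (measurableSet_Ioi (a := x)) {i}
  simp only [Finset.mem_singleton, forall_eq, Finset.prod_singleton, Set.mem_Ioi] at h1
  rw [h1]
  refine lintegral_congr_ae ?_
  filter_upwards [hmodel.ae_pi_lt_eveSINR hn η hPs hσ hζ0 hζ1 hx] with ω hω
  exact hω i

lemma measure_forall_sinrE_le (hmodel : IsWiretapModel P n lamE X h hsd G) (hn : 2 ≤ n)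
    {ζ Ps σn : ℝ} (η : ℝ) (hPs : 0 < Ps) (hσ : 0 < σn) (hζ0 : 0 < ζ) (hζ1 : ζ ≤ 1) {x : ℝ}
    (hx : 0 ≤ x) (s : Finset ℕ) :
    P {ω | ∀ i ∈ s, sinrE ζ Ps σn η X h hsd G i ω ≤ x} =
      ∫⁻ ω, ∏ i ∈ s, (1 - sinrTail n ζ Ps σn η x (X i ω)) ∂P := by
  have h1 := hmodel.measure_forall_sinrE_mem ζ Ps σn η (measurableSet_Iic (a := x)) s
  simp only [Set.mem_Iic] at h1
  rw [h1]
  refine lintegral_congr_ae ?_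
  filter_upwards [hmodel.ae_pi_lt_eveSINR hn η hPs hσ hζ0 hζ1 hx] with ω hω
  refine Finset.prod_congr rfl fun i _ => ?_
  rw [← hω i, ← prob_compl_eq_one_sub]
  · congr 1
    ext v
    simp
  · exact measurableSet_lt measurable_const
      (measurable_eveSINR ζ Ps σn η measurable_const measurable_const measurable_const
        measurable_id)

/-- At threshold `0` the function `sinrTail` is identically `1`. -/
lemma ae_sinrE_pos (hmodel : IsWiretapModel P n lamE X h hsd G) (hn : 2 ≤ n)
    {ζ Ps σn : ℝ} (η : ℝ) (hPs : 0 < Ps) (hσ : 0 < σn) (hζ0 : 0 < ζ) (hζ1 : ζ ≤ 1) (i : ℕ) :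
    ∀ᵐ ω ∂P, 0 < sinrE ζ Ps σn η X h hsd G i ω := by
  have h1 := hmodel.measure_lt_sinrE hn η hPs hσ hζ0 hζ1 le_rfl i
  simp only [sinrTail, zero_mul, zero_div, neg_zero, Real.exp_zero, mul_zero, add_zero,
    Real.one_rpow, mul_one, ENNReal.ofReal_one, lintegral_one, measure_univ] at h1
  exact (mem_ae_iff_prob_eq_one
    (measurableSet_lt measurable_const (hmodel.measurable_sinrE ζ Ps σn η i))).2 h1

/-- Borel-Cantelli: half of Campbell's formula bounds the sum of the tail probabilities by the
finite integral of `sinrTail`. -/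
lemma ae_finite_lt_sinrE (hmodel : IsWiretapModel P n lamE X h hsd G) (hn : 2 ≤ n)
    {ζ Ps σn η : ℝ} (hlam : 0 < lamE) (hPs : 0 < Ps) (hσ : 0 < σn) (hζ0 : 0 < ζ) (hζ1 : ζ ≤ 1)
    (hη : 2 < η) {x : ℝ} (hx : 0 < x) :
    ∀ᵐ ω ∂P, {i | x < sinrE ζ Ps σn η X h hsd G i ω}.Finite := by
  refine ae_finite_setOfPred_mem (s := fun i => {ω | x < sinrE ζ Ps σn η X h hsd G i ω}) ?_
  simp_rw [hmodel.measure_lt_sinrE hn η hPs hσ hζ0 hζ1 hx.le]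
  refine ne_top_of_le_ne_top ?_
    (hmodel.poisson.tsum_lintegral_le (measurable_sinrTail n ζ Ps σn η x))
  rw [lintegral_sinrTail hlam hPs hσ hζ0 hη hx]
  exact ENNReal.ofReal_ne_top

lemma ae_isGreatest_sinrNCE (hmodel : IsWiretapModel P n lamE X h hsd G) (hn : 2 ≤ n)
    {ζ Ps σn η : ℝ} (hlam : 0 < lamE) (hPs : 0 < Ps) (hσ : 0 < σn) (hζ0 : 0 < ζ) (hζ1 : ζ ≤ 1)
    (hη : 2 < η) :
    ∀ᵐ ω ∂P, IsGreatest (Set.range fun i => sinrE ζ Ps σn η X h hsd G i ω)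
      (sinrNCE ζ Ps σn η X h hsd G ω) := by
  -- Countably many levels tending to `0` share one null set; the positive SINR of eavesdropper `0`
  -- exceeds one of them.
  have hfin : ∀ᵐ ω ∂P, ∀ m : ℕ,
      {i | 1 / ((m : ℝ) + 1) < sinrE ζ Ps σn η X h hsd G i ω}.Finite :=
    ae_all_iff.2 fun m =>
      hmodel.ae_finite_lt_sinrE hn hlam hPs hσ hζ0 hζ1 hη Nat.one_div_pos_of_nat
  filter_upwards [hfin, hmodel.ae_sinrE_pos hn η hPs hσ hζ0 hζ1 0] with ω hω hpos
  obtain ⟨m, hm⟩ := exists_nat_one_div_lt hpos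
  obtain ⟨i, hi⟩ := exists_isGreatest_range_of_finite hm (hω m)
  have : sinrNCE ζ Ps σn η X h hsd G ω = sinrE ζ Ps σn η X h hsd G i ω := hi.csSup_eq
  rwa [this]

lemma measure_forall_sinrE_le_eq_exp (hmodel : IsWiretapModel P n lamE X h hsd G) (hn : 2 ≤ n)
    {ζ Ps σn η : ℝ} (hlam : 0 < lamE) (hPs : 0 < Ps) (hσ : 0 < σn) (hζ0 : 0 < ζ) (hζ1 : ζ ≤ 1)
    (hη : 2 < η) {x : ℝ} (hx : 0 < x) :
    P {ω | ∀ i, sinrE ζ Ps σn η X h hsd G i ω ≤ x} = ENNReal.ofReal (Real.exp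
      (-((Real.pi * Real.Gamma (1 + 2 / η)) * lamE * (ζ * (Ps / σn)) ^ (2 / η)
        * x ^ (-(2 / η)) * (1 + (1 / ζ - 1) / ((n : ℝ) - 1) * x) ^ (1 - (n : ℝ))))) := by
  have hset : {ω | ∀ i, sinrE ζ Ps σn η X h hsd G i ω ≤ x} =
      ⋂ N, {ω | ∀ i ∈ Finset.range N, sinrE ζ Ps σn η X h hsd G i ω ≤ x} := by
    ext ω
    simp only [Set.mem_ofPred_eq, Set.mem_iInter, Finset.mem_range]
    exact ⟨fun h N i _ => h i, fun h i => h (i + 1) i i.lt_succ_self⟩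
  have hanti : Antitone fun N =>
      {ω | ∀ i ∈ Finset.range N, sinrE ζ Ps σn η X h hsd G i ω ≤ x} :=
    fun N M hNM ω hω i hi => hω i (Finset.range_mono hNM hi)
  have hmeas : ∀ N, MeasurableSet
      {ω | ∀ i ∈ Finset.range N, sinrE ζ Ps σn η X h hsd G i ω ≤ x} := fun N => by
    simp only [Set.ofPred_forall]
    exact MeasurableSet.iInter fun i => MeasurableSet.iInter fun _ =>
      measurableSet_le (hmodel.measurable_sinrE ζ Ps σn η i) measurable_const
  -- Continuity from above gives the infimum over `N` that appears in the generating functional.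
  rw [hset, hanti.measure_iInter (fun N => (hmeas N).nullMeasurableSet) ⟨0, measure_ne_top _ _⟩]
  simp_rw [hmodel.measure_forall_sinrE_le hn η hPs hσ hζ0 hζ1 hx.le]
  have hI := lintegral_sinrTail (n := n) hlam hPs hσ hζ0 hη hx
  have hn1 : 0 < (n : ℝ) - 1 := by
    have : (2 : ℝ) ≤ n := by exact_mod_cast hn
    linarith
  have hζ : 0 ≤ 1 / ζ - 1 := by
    rw [sub_nonneg, le_div_iff₀ hζ0]
    linarith
  have hG : 0 < Real.Gamma (1 + 2 / η) :=
    Real.Gamma_pos_of_pos (by have : 0 < η := by linarith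
                              positivity)
  rw [hmodel.poisson.iInf_lintegral_prod (measurable_sinrTail n ζ Ps σn η x)
    (sinrTail_le_one hn hPs hσ hζ0 hζ1 hx.le) (by rw [hI]; exact ENNReal.ofReal_ne_top), hI,
    ENNReal.toReal_ofReal (by positivity)]

end IsWiretapModel

theorem lemma1 {Ω : Type*} [MeasurableSpace Ω] (P : Measure Ω) [IsProbabilityMeasure P]
    (n : ℕ) (hn : 2 ≤ n) (lamE Ps σn ζ η : ℝ) (hlam : 0 < lamE) (hPs : 0 < Ps) (hσ : 0 < σn)
    (hζ0 : 0 < ζ) (hζ1 : ζ ≤ 1) (hη : 2 < η)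
    (X : ℕ → Ω → Plane) (h : ℕ → Ω → Fin n → ℂ) (hsd : Ω → Fin n → ℂ)
    (G : Ω → Matrix (Fin n) (Fin (n - 1)) ℂ) (hmodel : IsWiretapModel P n lamE X h hsd G) :
    -- almost surely the maximum of the SINRs exists and is `sinrNCE`
    (∀ᵐ ω ∂P, IsGreatest (Set.range fun i => sinrE ζ Ps σn η X h hsd G i ω)
      (sinrNCE ζ Ps σn η X h hsd G ω)) ∧
    AEMeasurable (sinrNCE ζ Ps σn η X h hsd G) P ∧
    (∀ x : ℝ, 0 < x → cdf (P.map (sinrNCE ζ Ps σn η X h hsd G)) x =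
      Real.exp (-((Real.pi * Real.Gamma (1 + 2 / η)) * lamE * (ζ * (Ps / σn)) ^ (2 / η)
        * x ^ (-(2 / η)) * (1 + (1 / ζ - 1) / ((n : ℝ) - 1) * x) ^ (1 - (n : ℝ))))) ∧
    (∀ x : ℝ, x ≤ 0 → cdf (P.map (sinrNCE ζ Ps σn η X h hsd G)) x = 0) := by
  have hgreat := hmodel.ae_isGreatest_sinrNCE hn hlam hPs hσ hζ0 hζ1 hη
  have hmeas : Measurable (sinrNCE ζ Ps σn η X h hsd G) :=
    Measurable.iSup fun i => hmodel.measurable_sinrE ζ Ps σn η i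
  have : IsProbabilityMeasure (P.map (sinrNCE ζ Ps σn η X h hsd G)) :=
    Measure.isProbabilityMeasure_map hmeas.aemeasurable
  -- Attainment matters here: the real `⨆` of an unbounded family is `0` by convention, so a bound
  -- on it alone would not bound every SINR.
  have hcdf : ∀ x, cdf (P.map (sinrNCE ζ Ps σn η X h hsd G)) x =
      P.real {ω | ∀ i, sinrE ζ Ps σn η X h hsd G i ω ≤ x} := by
    intro x
    rw [cdf_eq_real, map_measureReal_apply hmeas measurableSet_Iic]
    refine measureReal_congr ?_
    filter_upwards [hgreat] with ω hω
    refine propext ⟨fun hle i => (hω.2 ⟨i, rfl⟩).trans hle, fun hle => ?_⟩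
    obtain ⟨i, hi⟩ := hω.1
    change sinrNCE ζ Ps σn η X h hsd G ω ≤ x
    rw [← hi]
    exact hle i
  refine ⟨hgreat, hmeas.aemeasurable, fun x hx => ?_, fun x hx => ?_⟩
  · rw [hcdf, measureReal_def,
      hmodel.measure_forall_sinrE_le_eq_exp hn hlam hPs hσ hζ0 hζ1 hη hx,
      ENNReal.toReal_ofReal (Real.exp_pos _).le]
  · rw [hcdf, measureReal_eq_zero_iff, measure_eq_zero_iff_ae_notMem]
    filter_upwards [hmodel.ae_sinrE_pos hn η hPs hσ hζ0 hζ1 0] with ω hω hle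
    exact absurd ((hle 0).trans hx) (not_le.2 hω)
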